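/- **Setting.** Let $\mathcal Z$ be a set of data points and $\mathcal H$ a set of decisions. Let $L:\bigcup_k\mathcal Z^k\to\mathcal H$ be any map from finite lists of data points to decisions (possibly depending on the order of the list), let $h_0\in\mathcal H$ be any initial decision, and let $\varphi:\mathcal H\times\mathcal Z\to\{0,1\}$ be any map, where $\varphi(h,z)=1$ means that $h$ satisfies the property of interest at $z$. For each $h\in\mathcal H$, every point $z$ with $\varphi(h,z)=0$ is assigned a degree of dissatisfaction in a totally ordered set, distinct points receiving distinct degrees. The maps are assumed measurable, in the sense that for the decision $h$ built from a list $T\in\mathcal Z^k$ ($h=h_0$ if $T$ is empty, $h=L(T)$ otherwise), $\varphi(h,z)$ is jointly measurable in $(T,z)$, and the set of all $(T,z,z')$ with $\varphi(h,z)=\varphi(h,z')=0$ for which $z$ has a lower degree of dissatisfaction with $h$ than $z'$ is measurable. Given a list $D=(z_1,\dots,z_N)$ of elements of $\mathcal Z$, the algorithm P2L starts from the empty list $T$ and $h=h_0$. As long as some element $z$ of $D\setminus T$ (the list obtained from $D$ by removing the elements of $T$, counted with repetitions) has $\varphi(h,z)=0$, it appends to $T$ the element $\bar z$ of $D\setminus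 T$ with $\varphi(h,\bar z)=0$ that has the highest degree of dissatisfaction with $h$, and then sets $h=L(T)$. When every element of $D\setminus T$ satisfies $\varphi(h,z)=1$ it stops and returns $(h,T)=\mathrm{P2L}(D)$. Let $|T|$ denote the length of $T$. **Theorem.** Let $\boldsymbol z_1,\dots,\boldsymbol z_N$ be independent random elements of $\mathcal Z$ with common distribution $\mathbb P_z$, defined on a probability space with probability $\mathbb P$, let $\boldsymbol D=(\boldsymbol z_1,\dots,\boldsymbol z_N)$ and $(\boldsymbol h,\boldsymbol T)=\mathrm{P2L}(\boldsymbol D)$, and let $R(h)=\mathbb P_z[z:\varphi(h,z)=0]$ be the risk of a decision $h$. Let $\delta\in(0,1)$. For $k=0,1,\dots,N-1$ the equation $\Psi_{k,\delta}(\varepsilon)=1$, where $$\Psi_{k,\delta}(\varepsilon)=\frac{\delta}{N}\sum_{m=k}^{N-1}\frac{\binom mk}{\binom Nk}(1-\varepsilon)^{-(N-m)},\qquad \varepsilon<1,$$ has exactly one solution in the interval $[k/N,1]$, denoted $\bar\varepsilon(k,\delta,N)$; set $\bar\varepsilon(N,\delta,N)=1$. Then $\{R(\boldsymbol h)\le\bar\varepsilon(|\boldsymbol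 T|,\delta,N)\}$ is an event and $$\mathbb P\{R(\boldsymbol h)\le\bar\varepsilon(|\boldsymbol T|,\delta,N)\}\ge 1-\delta .$$ -/

import Mathlib

open MeasureTheory ProbabilityTheory

namespace PickToLearn

/-- The decision in force when the training list is `T`: the initial decision `h₀` as long as
nothing has been picked, and the output `L T` of the synthesis algorithm afterwards. -/
def decision {Z H : Type*} (L : List Z → H) (h₀ : H) (T : List Z) : H :=
  match T with
  | [] => h₀
  | z :: T' => L (z :: T')

/-- The most unsatisfied point of the list `R` for the decision `h`: the point with the highest
degree of dissatisfaction `q h` among those with `φ h z = false` (that is, `φ(h, z) = 0`).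
It is `none` exactly when every point of `R` satisfies the property. -/
def mostUnsatisfied {Z H Δ : Type*} [LinearOrder Δ] (φ : H → Z → Bool) (q : H → Z → Δ)
    (h : H) (R : List Z) : Option Z :=
  (R.filter (fun z => !φ h z)).argmax (q h)

theorem mostUnsatisfied_eq_none {Z H Δ : Type*} [LinearOrder Δ] {φ : H → Z → Bool}
    {q : H → Z → Δ} {h : H} {R : List Z} :
    mostUnsatisfied φ q h R = none ↔ ¬ ∃ z ∈ R, φ h z = false := by
  simp [mostUnsatisfied]

theorem mem_of_mostUnsatisfied {Z H Δ : Type*} [LinearOrder Δ] {φ : H → Z → Bool}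
    {q : H → Z → Δ} {h : H} {R : List Z} {z : Z} (hz : mostUnsatisfied φ q h R = some z) :
    z ∈ R :=
  (List.mem_filter.1 (List.argmax_mem hz)).1

open Classical in
theorem length_diff_append_lt {Z : Type*} {D T : List Z} {z : Z} (hz : z ∈ D.diff T) :
    (D.diff (T ++ [z])).length < (D.diff T).length := by
  rw [List.diff_append, List.diff_cons, List.diff_nil, List.length_erase_of_mem hz]
  have := List.length_pos_of_mem hz
  omega

open Classical in
/-- The `while` loop of the meta-algorithm P2L on the dataset `D`, started with the training list
`T`: as long as some point of `D \ T` (removal of list elements, counted with repetitions) does not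
satisfy the property, append the most unsatisfied point of `D \ T` to `T` and recompute the
decision; then return the decision and `T`. -/
noncomputable def loop {Z H Δ : Type*} [LinearOrder Δ] (L : List Z → H) (h₀ : H)
    (φ : H → Z → Bool) (q : H → Z → Δ) (D T : List Z) : H × List Z :=
  match _hz : mostUnsatisfied φ q (decision L h₀ T) (D.diff T) with
  | none => (decision L h₀ T, T)
  | some z => loop L h₀ φ q D (T ++ [z])
termination_by (D.diff T).length
decreasing_by exact length_diff_append_lt (mem_of_mostUnsatisfied _hz)

/-- The meta-algorithm P2L: it maps the dataset `D` to the pair `(h, T)`. -/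
noncomputable def P2L {Z H Δ : Type*} [LinearOrder Δ] (L : List Z → H) (h₀ : H)
    (φ : H → Z → Bool) (q : H → Z → Δ) (D : List Z) : H × List Z :=
  loop L h₀ φ q D []

/-- The risk `R(h)`: the probability that a new point does not satisfy the property. -/
noncomputable def risk {Z H : Type*} [MeasurableSpace Z] (Pz : Measure Z) (φ : H → Z → Bool)
    (h : H) : ℝ :=
  Pz.real {z | φ h z = false}

/-- `Ψ_{k,δ}(ε) = (δ / N) ∑_{m=k}^{N-1} (m choose k) / (N choose k) (1 - ε)^{-(N-m)}`. -/
noncomputable def Psi (N k : ℕ) (δ ε : ℝ) : ℝ :=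
  δ / N * ∑ m ∈ Finset.Ico k N,
    (m.choose k : ℝ) / (N.choose k : ℝ) * (1 - ε) ^ (-((N : ℤ) - (m : ℤ)))

/-- `ε` solves `Ψ_{k,δ}(ε) = 1` in the interval `[k/N, 1]`. -/
def IsPsiRoot (N k : ℕ) (δ ε : ℝ) : Prop :=
  ε ∈ Set.Icc ((k : ℝ) / (N : ℝ)) 1 ∧ Psi N k δ ε = 1

/-- The bound `ε̄(k, δ, N)`: the solution of `Ψ_{k,δ}(ε) = 1` in `[k/N, 1]` for `k < N` (it is part
of the theorem that there is exactly one), and `1` for `k = N`. -/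
noncomputable def epsBar (k : ℕ) (δ : ℝ) (N : ℕ) : ℝ :=
  if k < N then Classical.epsilon (fun ε : ℝ => IsPsiRoot N k δ ε) else 1

end PickToLearn

/-! ### The equation Ψ = 1 and its root -/

namespace PickToLearn

/-! Train on a subset `S` of the indices and hold out the other `N - |S|` points. Given the points
in `S`, the trained decision is fixed, and with `c` its probability of satisfaction, the held-out
points are all satisfied with probability `c ^ (N - |S|)`. The indicator of this event divided by
that probability, `holdoutWeight`, therefore has mean at most 1 (`lintegral_holdoutWeight_le`).
Averaging over the `S` of size `m`, summing over `m < N` and multiplying by `δ / N` gives a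
statistic of mean at most `δ`.

The greedy choice makes P2L a stable compression scheme: if `J` is the set of the `k` picked
indices, every `S ⊇ J` leads to the same run (`IsTrace.mono`), and the points outside `S` are all
satisfied (`IsTrace.satisfied`). The average over size `m` is thus at least `(N-k choose m-k) / (N
choose m) * c ^ (-(N-m))`, whose coefficient equals `(m choose k) / (N choose k)`. When `c > 0` the
statistic hence dominates Ψ at the risk `1 - c`, and Ψ is at least 1 there once the risk exceeds its
root (`one_le_sum_holdoutWeight`). Markov's inequality bounds the probability of that by `δ`. -/

theorem choose_div_choose_eq {N m k : ℕ} (hkm : k ≤ m) (hmN : m ≤ N) :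
    (m.choose k : ℝ) / (N.choose k : ℝ) = ((N - k).choose (m - k) : ℝ) / (N.choose m : ℝ) := by
  have h1 : (N.choose k : ℝ) ≠ 0 := by
    exact_mod_cast (Nat.choose_pos (hkm.trans hmN)).ne'
  have h2 : (N.choose m : ℝ) ≠ 0 := by exact_mod_cast (Nat.choose_pos hmN).ne'
  rw [div_eq_div_iff h1 h2, mul_comm, mul_comm ((N - k).choose (m - k) : ℝ)]
  exact_mod_cast Nat.choose_mul (n := N) hkm

theorem Psi_eq (N k : ℕ) (δ ε : ℝ) :
    Psi N k δ ε = δ / N * ∑ m ∈ Finset.Ico k N,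
      (m.choose k : ℝ) / (N.choose k : ℝ) * ((1 - ε) ^ (N - m))⁻¹ := by
  unfold Psi
  congr 1
  refine Finset.sum_congr rfl fun m hm => ?_
  have hm' := (Finset.mem_Ico.1 hm).2.le
  rw [zpow_neg, ← Nat.cast_sub hm', zpow_natCast]

/-- The ratio of `(M choose k)` to `(M+1 choose k)` is `1 - k/(M+1)`, which is at most `1 - k/N` as
long as `M + 1 ≤ N`; this is iterated `d` times. For `m + d = N` it bounds by 1 each summand of Ψ at
`k/N`. -/
theorem choose_mul_pow_le {N k : ℕ} (d : ℕ) {m : ℕ} (hkm : k ≤ m) (hmN : m + d ≤ N) :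
    (m.choose k : ℝ) * (N : ℝ) ^ d ≤ ((m + d).choose k : ℝ) * ((N : ℝ) - k) ^ d := by
  induction d with
  | zero => simp
  | succ d ih =>
    have hkN : (k : ℝ) ≤ N := by exact_mod_cast (by omega : k ≤ N)
    have hle : ((m + d).choose k : ℝ) * N ≤ ((m + d + 1).choose k : ℝ) * ((N : ℝ) - k) := by
      have e : ((m + d).choose k : ℝ) * ((m + d : ℕ) + 1 : ℝ)
          = ((m + d + 1).choose k : ℝ) * (((m + d : ℕ) + 1 : ℝ) - k) := by
        have := Nat.choose_mul_succ_eq (m + d) k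
        have h2 : ((m + d + 1 - k : ℕ) : ℝ) = ((m + d : ℕ) + 1 : ℝ) - k := by
          rw [Nat.cast_sub (by omega)]; push_cast; ring
        rw [← h2]
        exact_mod_cast this
      have hM : (0 : ℝ) < ((m + d : ℕ) + 1 : ℝ) := by positivity
      have hMN : (((m + d : ℕ) + 1 : ℝ)) ≤ N := by exact_mod_cast hmN
      refine le_of_mul_le_mul_right ?_ hM
      have hC : (0 : ℝ) ≤ ((m + d + 1).choose k : ℝ) := by positivity
      have hk0 : (0 : ℝ) ≤ k := by positivity
      calc ((m + d).choose k : ℝ) * N * ((m + d : ℕ) + 1 : ℝ)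
          = ((m + d + 1).choose k : ℝ) * ((((m + d : ℕ) + 1 : ℝ) - k) * N) := by
            rw [mul_right_comm, e]; ring
        _ ≤ ((m + d + 1).choose k : ℝ) * (((N : ℝ) - k) * ((m + d : ℕ) + 1 : ℝ)) := by
            refine mul_le_mul_of_nonneg_left ?_ hC
            nlinarith
        _ = _ := by ring
    calc (m.choose k : ℝ) * (N : ℝ) ^ (d + 1) = ((m.choose k : ℝ) * (N : ℝ) ^ d) * N := by ring
      _ ≤ (((m + d).choose k : ℝ) * ((N : ℝ) - k) ^ d) * N :=
          mul_le_mul_of_nonneg_right (ih (by omega)) (by positivity)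
      _ = (((m + d).choose k : ℝ) * N) * ((N : ℝ) - k) ^ d := by ring
      _ ≤ (((m + d + 1).choose k : ℝ) * ((N : ℝ) - k)) * ((N : ℝ) - k) ^ d :=
          mul_le_mul_of_nonneg_right hle (pow_nonneg (by linarith) _)
      _ = _ := by rw [← add_assoc]; ring

theorem Psi_div_le {N k : ℕ} (hk : k < N) {δ : ℝ} (hδ : 0 ≤ δ) :
    Psi N k δ ((k : ℝ) / N) ≤ δ := by
  have hN : (0 : ℝ) < N := by exact_mod_cast (by omega : 0 < N)
  have hkN : (k : ℝ) < N := by exact_mod_cast hk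
  rw [Psi_eq]
  have hsum : ∑ m ∈ Finset.Ico k N,
      (m.choose k : ℝ) / (N.choose k : ℝ) * ((1 - (k : ℝ) / N) ^ (N - m))⁻¹ ≤ N := by
    calc _ ≤ ∑ m ∈ Finset.Ico k N, (1 : ℝ) := by
          refine Finset.sum_le_sum fun m hm => ?_
          obtain ⟨h1, h2⟩ := Finset.mem_Ico.1 hm
          have h := choose_mul_pow_le (N := N) (N - m) h1 (by omega)
          rw [Nat.add_sub_cancel' h2.le] at h
          have hC : (0 : ℝ) < (N.choose k : ℝ) := by exact_mod_cast Nat.choose_pos hk.le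
          have hp : 0 < 1 - (k : ℝ) / N := by rw [sub_pos, div_lt_one hN]; exact hkN
          rw [← div_eq_mul_inv, div_div, div_le_one (by positivity)]
          have e : (N : ℝ) - k = (1 - (k : ℝ) / N) * N := by field_simp
          rw [e, mul_pow, ← mul_assoc] at h
          exact le_of_mul_le_mul_right h (by positivity)
      _ = ((N - k : ℕ) : ℝ) := by simp
      _ ≤ N := by exact_mod_cast Nat.sub_le N k
  calc _ ≤ δ / N * N := mul_le_mul_of_nonneg_left hsum (by positivity)
    _ = δ := by field_simp

theorem Psi_strictMonoOn {N k : ℕ} (hk : k < N) {δ : ℝ} (hδ : 0 < δ) :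
    StrictMonoOn (Psi N k δ) (Set.Iio 1) := by
  intro a ha b hb hab
  have hN : (0 : ℝ) < N := by exact_mod_cast (by omega : 0 < N)
  have hb' : 0 < 1 - b := sub_pos.2 hb
  rw [Psi_eq, Psi_eq]
  refine mul_lt_mul_of_pos_left (Finset.sum_lt_sum_of_nonempty (by simpa using hk) ?_)
    (by positivity)
  intro m hm
  obtain ⟨h1, h2⟩ := Finset.mem_Ico.1 hm
  have hC : (0 : ℝ) < (N.choose k : ℝ) := by exact_mod_cast Nat.choose_pos hk.le
  have hC' : (0 : ℝ) < (m.choose k : ℝ) := by exact_mod_cast Nat.choose_pos h1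
  refine mul_lt_mul_of_pos_left ?_ (by positivity)
  refine inv_strictAnti₀ (by positivity) ?_
  exact pow_lt_pow_left₀ (by linarith) hb'.le (by omega)

theorem Psi_continuousOn (N k : ℕ) (δ : ℝ) : ContinuousOn (Psi N k δ) (Set.Iio 1) := by
  have : Psi N k δ = fun ε => δ / N * ∑ m ∈ Finset.Ico k N,
      (m.choose k : ℝ) / (N.choose k : ℝ) * ((1 - ε) ^ (N - m))⁻¹ := funext (Psi_eq N k δ)
  rw [this]
  refine continuousOn_const.mul (continuousOn_finsetSum _ fun m _ => continuousOn_const.mul ?_)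
  refine ContinuousOn.inv₀ (by fun_prop) fun ε hε => ?_
  exact pow_ne_zero _ (sub_pos.2 hε).ne'

/-- The pole at 1 takes the default value `0⁻¹ = 0`, so the closed endpoint of `[k/N, 1]` adds no
spurious root. -/
theorem Psi_one (N k : ℕ) (δ : ℝ) : Psi N k δ 1 = 0 := by
  rw [Psi_eq, Finset.sum_eq_zero, mul_zero]
  intro m hm
  have := (Finset.mem_Ico.1 hm).2
  rw [sub_self, zero_pow (by omega), inv_zero, mul_zero]

theorem exists_one_le_Psi {N k : ℕ} (hk : k < N) {δ : ℝ} (hδ : 0 < δ) :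
    ∃ b < 1, (k : ℝ) / N ≤ b ∧ 1 ≤ Psi N k δ b := by
  have hN : (0 : ℝ) < N := by exact_mod_cast (by omega : 0 < N)
  have hkN : (k : ℝ) < N := by exact_mod_cast hk
  have hC : (0 : ℝ) < (N.choose k : ℝ) := by exact_mod_cast Nat.choose_pos hk.le
  have hC' : (0 : ℝ) < ((N - 1).choose k : ℝ) := by
    exact_mod_cast Nat.choose_pos (by omega : k ≤ N - 1)
  -- The summand `m = N - 1` contributes exactly `c / (1 - ε)` to Ψ, so it alone reaches 1 once `1 -
  -- ε ≤ c`.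
  set c : ℝ := δ / N * (((N - 1).choose k : ℝ) / (N.choose k : ℝ)) with hc
  have hc0 : 0 < c := by positivity
  refine ⟨max ((k : ℝ) / N) (1 - c), ?_, le_max_left _ _, ?_⟩
  · exact max_lt ((div_lt_one hN).2 hkN) (by linarith)
  set b := max ((k : ℝ) / N) (1 - c) with hb
  have hb1 : b < 1 := max_lt ((div_lt_one hN).2 hkN) (by linarith)
  have hbc : 1 - b ≤ c := by linarith [le_max_right ((k : ℝ) / N) (1 - c)]
  have hb0 : 0 < 1 - b := sub_pos.2 hb1
  rw [Psi_eq]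
  calc 1 ≤ c * (1 - b)⁻¹ := by rw [← div_eq_mul_inv, one_le_div hb0]; exact hbc
    _ = δ / N * (((N - 1).choose k : ℝ) / (N.choose k : ℝ) * ((1 - b) ^ (N - (N - 1)))⁻¹) := by
      rw [show N - (N - 1) = 1 by omega, pow_one, hc, mul_assoc]
    _ ≤ _ := by
      refine mul_le_mul_of_nonneg_left ?_ (by positivity)
      refine Finset.single_le_sum (f := fun m => (m.choose k : ℝ) / (N.choose k : ℝ)
        * ((1 - b) ^ (N - m))⁻¹) (fun m _ => by positivity) ?_
      exact Finset.mem_Ico.2 ⟨by omega, by omega⟩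

theorem IsPsiRoot.lt_one {N k : ℕ} {δ ε : ℝ} (h : IsPsiRoot N k δ ε) : ε < 1 := by
  refine lt_of_le_of_ne h.1.2 ?_
  rintro rfl
  simpa [Psi_one] using h.2

theorem existsUnique_isPsiRoot {N k : ℕ} (hk : k < N) {δ : ℝ} (hδ : δ ∈ Set.Ioo (0 : ℝ) 1) :
    ∃! ε : ℝ, IsPsiRoot N k δ ε := by
  obtain ⟨b, hb1, hb, hb'⟩ := exists_one_le_Psi hk hδ.1
  have hcont : ContinuousOn (Psi N k δ) (Set.Icc ((k : ℝ) / N) b) :=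
    (Psi_continuousOn N k δ).mono fun x hx => lt_of_le_of_lt hx.2 hb1
  obtain ⟨ε, hε, hε'⟩ := intermediate_value_Icc hb hcont
    ⟨(Psi_div_le hk hδ.1.le).trans hδ.2.le, hb'⟩
  refine ⟨ε, ⟨⟨hε.1, hε.2.trans hb1.le⟩, hε'⟩, fun ε' h => ?_⟩
  exact (Psi_strictMonoOn hk hδ.1).injOn h.lt_one (lt_of_le_of_lt hε.2 hb1) (h.2.trans hε'.symm)

theorem isPsiRoot_epsBar {N k : ℕ} (hk : k < N) {δ : ℝ} (hδ : δ ∈ Set.Ioo (0 : ℝ) 1) :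
    IsPsiRoot N k δ (epsBar k δ N) := by
  rw [epsBar, if_pos hk]
  exact Classical.epsilon_spec (existsUnique_isPsiRoot hk hδ).exists

theorem one_le_Psi_of_epsBar_lt {N k : ℕ} (hk : k < N) {δ : ℝ} (hδ : δ ∈ Set.Ioo (0 : ℝ) 1)
    {r : ℝ} (hr : epsBar k δ N < r) (hr1 : r < 1) : 1 ≤ Psi N k δ r := by
  have h := isPsiRoot_epsBar hk hδ
  rw [← h.2]
  exact ((Psi_strictMonoOn hk hδ.1) h.lt_one hr1 hr).le

end PickToLearn

/-! ### Runs of P2L as sequences of indices -/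

namespace PickToLearn

variable {Z H Δ ι : Type*} [LinearOrder Δ]

/-- The indices `l'` are a possible continuation of the run of P2L on the points `x i`, when the
indices picked so far are `l` and those still available are `s`. -/
def IsTrace [DecidableEq ι] (L : List Z → H) (h₀ : H) (φ : H → Z → Bool) (q : H → Z → Δ)
    (x : ι → Z) (s : Finset ι) (l : List ι) : List ι → Prop
  | [] => ∀ i ∈ s, φ (decision L h₀ (l.map x)) (x i) = true
  | i :: l' => i ∈ s ∧ φ (decision L h₀ (l.map x)) (x i) = false ∧
      (∀ j ∈ s, ¬ (φ (decision L h₀ (l.map x)) (x i) = false ∧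
        φ (decision L h₀ (l.map x)) (x j) = false ∧
        q (decision L h₀ (l.map x)) (x i) < q (decision L h₀ (l.map x)) (x j))) ∧
      IsTrace L h₀ φ q x (s.erase i) (l ++ [i]) l'

theorem mostUnsatisfied_eq_some {φ : H → Z → Bool} {q : H → Z → Δ} {h : H} {R : List Z} {a : Z}
    (hq : Set.InjOn (q h) {z | φ h z = false}) (ha : a ∈ R) (ha' : φ h a = false)
    (hmax : ∀ b ∈ R, φ h b = false → q h b ≤ q h a) : mostUnsatisfied φ q h R = some a := by
  cases hm : mostUnsatisfied φ q h R with
  | none => exact absurd ⟨a, ha, ha'⟩ (mostUnsatisfied_eq_none.1 hm)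
  | some b =>
    have hb := List.mem_filter.1 (List.argmax_mem hm)
    have hb' : φ h b = false := by simpa using hb.2
    have h1 := hmax b hb.1 hb'
    have h2 : q h a ≤ q h b :=
      List.le_of_mem_argmax (List.mem_filter.2 ⟨ha, by simpa using ha'⟩) hm
    rw [hq hb' ha' (le_antisymm h1 h2)]

open Classical in
theorem exists_isTrace (L : List Z → H) (h₀ : H) (φ : H → Z → Bool) (q : H → Z → Δ)
    (x : ι → Z) (s : Finset ι) (l : List ι) : ∃ l', IsTrace L h₀ φ q x s l l' := by
  induction hn : s.card generalizing s l with
  | zero =>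
    refine ⟨[], ?_⟩
    simp [IsTrace, Finset.card_eq_zero.1 hn]
  | succ n ih =>
    by_cases h : ∀ i ∈ s, φ (decision L h₀ (l.map x)) (x i) = true
    · exact ⟨[], h⟩
    · push Not at h
      obtain ⟨i, hi, hmax⟩ := Finset.exists_max_image
        (s.filter fun i => φ (decision L h₀ (l.map x)) (x i) = false)
        (fun i => q (decision L h₀ (l.map x)) (x i))
        (by obtain ⟨i, hi, hi'⟩ := h; exact ⟨i, by simp [hi, hi']⟩)
      rw [Finset.mem_filter] at hi
      obtain ⟨l', hl'⟩ := ih (s.erase i) (l ++ [i]) (by rw [Finset.card_erase_of_mem hi.1]; omega)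
      refine ⟨i :: l', hi.1, hi.2, fun j hj hlt => ?_, hl'⟩
      exact absurd hlt.2.2 (not_lt.2 (hmax j (Finset.mem_filter.2 ⟨hj, hlt.2.1⟩)))

open Classical in
-- The loop removes values and a trace removes indices; the invariant `hD` matches them as
-- multisets. Injectivity of `q h` on unsatisfied points makes the picked value unique, so neither
-- the order of the data nor the choice among indices carrying equal points matters.
theorem loop_eq_of_isTrace {L : List Z → H} {h₀ : H} {φ : H → Z → Bool} {q : H → Z → Δ}
    (hq : ∀ h : H, Set.InjOn (q h) {z | φ h z = false}) {x : ι → Z} {D : List Z} (l' : List ι)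
    {s : Finset ι} {l : List ι} (hD : ((D.diff (l.map x) : List Z) : Multiset Z) = s.val.map x)
    (h : IsTrace L h₀ φ q x s l l') :
    loop L h₀ φ q D (l.map x) = (decision L h₀ ((l ++ l').map x), (l ++ l').map x) := by
  have hmem : ∀ a, a ∈ D.diff (l.map x) ↔ ∃ i ∈ s, x i = a := by
    intro a
    rw [← Multiset.mem_coe, hD]
    simp
  induction l' generalizing s l with
  | nil =>
    rw [loop]
    split
    · simp
    · rename_i a ha
      have h1 := List.mem_filter.1 (List.argmax_mem ha)
      obtain ⟨i, hi, rfl⟩ := (hmem a).1 h1.1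
      simp [h i hi] at h1
  | cons i l' ih =>
    obtain ⟨hi, hi', hmax, htr⟩ := h
    have hsome : mostUnsatisfied φ q (decision L h₀ (l.map x)) (D.diff (l.map x)) = some (x i) := by
      refine mostUnsatisfied_eq_some (hq _) ((hmem _).2 ⟨i, hi, rfl⟩) hi' fun b hb hb' => ?_
      obtain ⟨j, hj, rfl⟩ := (hmem b).1 hb
      exact not_lt.1 fun hlt => hmax j hj ⟨hi', hb', hlt⟩
    have hD' : ((D.diff ((l ++ [i]).map x) : List Z) : Multiset Z) = (s.erase i).val.map x := by
      rw [List.map_append, List.diff_append, List.map_singleton, List.diff_cons, List.diff_nil,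
        ← Multiset.coe_erase, hD, Finset.erase_val, Multiset.map_erase_of_mem _ _ hi]
    rw [loop]
    split
    · rename_i hn
      rw [hsome] at hn
      cases hn
    · rename_i a ha
      rw [hsome] at ha
      cases ha
      have := ih hD' htr (fun a => by rw [← Multiset.mem_coe, hD', Multiset.mem_map]; rfl)
      simpa using this

variable {N : ℕ}

theorem P2L_eq_of_isTrace {L : List Z → H} {h₀ : H} {φ : H → Z → Bool} {q : H → Z → Δ}
    (hq : ∀ h : H, Set.InjOn (q h) {z | φ h z = false}) [Fintype ι] [DecidableEq ι] {x : ι → Z}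
    {D : List Z} {s : Finset ι} {l : List ι} (hD : (D : Multiset Z) = s.val.map x)
    (h : IsTrace L h₀ φ q x s [] l) :
    P2L L h₀ φ q D = (decision L h₀ (l.map x), l.map x) := by
  have h' : @IsTrace Z H Δ ι _ (Classical.decEq ι) L h₀ φ q x s [] l := by
    convert h
  exact loop_eq_of_isTrace hq l (l := []) (s := s) (by simpa using hD) (by convert h')

/-- The training list produced by P2L from the data points `x i`, `i ∈ s`. -/
noncomputable def trainList (L : List Z → H) (h₀ : H) (φ : H → Z → Bool) (q : H → Z → Δ)
    (x : ι → Z) (s : Finset ι) : List Z :=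
  (P2L L h₀ φ q (s.val.map x).toList).2

/-- This locality is what makes the decision trained on `s` constant when conditioning on the points
in `s`. -/
theorem trainList_congr {L : List Z → H} {h₀ : H} {φ : H → Z → Bool} {q : H → Z → Δ}
    {x y : ι → Z} {s : Finset ι} (h : ∀ i ∈ s, x i = y i) :
    trainList L h₀ φ q x s = trainList L h₀ φ q y s := by
  rw [trainList, trainList, Multiset.map_congr rfl h]

variable [Fintype ι] [DecidableEq ι]

theorem trainList_eq_of_isTrace {L : List Z → H} {h₀ : H} {φ : H → Z → Bool} {q : H → Z → Δ}
    (hq : ∀ h : H, Set.InjOn (q h) {z | φ h z = false}) {x : ι → Z} {s : Finset ι} {l : List ι}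
    (h : IsTrace L h₀ φ q x s [] l) : trainList L h₀ φ q x s = l.map x := by
  rw [trainList, P2L_eq_of_isTrace hq (Multiset.coe_toList _) h]

theorem P2L_ofFn {L : List Z → H} {h₀ : H} {φ : H → Z → Bool} {q : H → Z → Δ}
    (hq : ∀ h : H, Set.InjOn (q h) {z | φ h z = false}) (x : Fin N → Z) :
    P2L L h₀ φ q (List.ofFn x) = (decision L h₀ (trainList L h₀ φ q x Finset.univ),
      trainList L h₀ φ q x Finset.univ) := by
  obtain ⟨l, hl⟩ := exists_isTrace L h₀ φ q x Finset.univ []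
  have hl' : IsTrace L h₀ φ q x Finset.univ [] l := by convert hl
  rw [trainList_eq_of_isTrace hq hl', P2L_eq_of_isTrace hq _ hl']
  exact (Fin.univ_val_map x).symm

omit [Fintype ι] in
theorem IsTrace.subset_and_nodup {L : List Z → H} {h₀ : H} {φ : H → Z → Bool} {q : H → Z → Δ}
    {x : ι → Z} {s : Finset ι} {l l' : List ι} (h : IsTrace L h₀ φ q x s l l') :
    (∀ i ∈ l', i ∈ s) ∧ l'.Nodup := by
  induction l' generalizing s l with
  | nil => simp
  | cons i l' ih =>
    obtain ⟨hi, -, -, htr⟩ := h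
    obtain ⟨h1, h2⟩ := ih htr
    refine ⟨?_, ?_⟩
    · intro j hj
      rcases List.mem_cons.1 hj with rfl | hj
      · exact hi
      · exact Finset.mem_of_mem_erase (h1 j hj)
    · exact List.nodup_cons.2 ⟨fun hi' => absurd (h1 i hi') (by simp), h2⟩

omit [Fintype ι] in
-- Stability of the compression: a maximizer over `s` that survives in `t` is still a maximizer over
-- `t`, and the stopping condition passes to subsets. Discarding points that are never picked leaves
-- the run unchanged.
theorem IsTrace.mono {L : List Z → H} {h₀ : H} {φ : H → Z → Bool} {q : H → Z → Δ}
    {x : ι → Z} {s t : Finset ι} {l l' : List ι} (h : IsTrace L h₀ φ q x s l l') (hts : t ⊆ s)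
    (hl' : ∀ i ∈ l', i ∈ t) : IsTrace L h₀ φ q x t l l' := by
  have hnd := h.subset_and_nodup.2
  induction l' generalizing s t l with
  | nil => exact fun i hi => h i (hts hi)
  | cons i l' ih =>
    obtain ⟨hi, hi', hmax, htr⟩ := h
    rw [List.nodup_cons] at hnd
    refine ⟨hl' i (by simp), hi', fun j hj => hmax j (hts hj),
      ih htr (Finset.erase_subset_erase i hts) ?_ hnd.2⟩
    intro j hj
    refine Finset.mem_erase.2 ⟨?_, hl' j (by simp [hj])⟩
    rintro rfl
    exact hnd.1 hj

omit [Fintype ι] in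
theorem IsTrace.satisfied {L : List Z → H} {h₀ : H} {φ : H → Z → Bool} {q : H → Z → Δ}
    {x : ι → Z} {s : Finset ι} {l l' : List ι} (h : IsTrace L h₀ φ q x s l l') {i : ι}
    (hi : i ∈ s) (hi' : i ∉ l') : φ (decision L h₀ ((l ++ l').map x)) (x i) = true := by
  induction l' generalizing s l with
  | nil => simpa using h i hi
  | cons j l' ih =>
    obtain ⟨-, -, -, htr⟩ := h
    have := ih htr (Finset.mem_erase.2 ⟨fun h => hi' (by simp [h]), hi⟩)
      (fun h => hi' (by simp [h]))
    simpa using this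

end PickToLearn

/-! ### Held-out test weights: measurability and mean -/

namespace PickToLearn

open scoped ENNReal

variable {Z H Δ ι : Type*} [LinearOrder Δ]

/-- The decision produced by P2L from the data points `x i`, `i ∈ s`. -/
noncomputable def trainedDecision (L : List Z → H) (h₀ : H) (φ : H → Z → Bool) (q : H → Z → Δ)
    (x : ι → Z) (s : Finset ι) : H :=
  decision L h₀ (trainList L h₀ φ q x s)

/-- The probability that a new point satisfies the property for the decision `h`. -/
noncomputable def confidence [MeasurableSpace Z] (Pz : Measure Z) (φ : H → Z → Bool) (h : H) :
    ℝ≥0∞ :=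
  Pz {z | φ h z = true}

/-- The test that the points outside `s` satisfy the property for the decision trained on `s`,
normalized by its conditional probability given the points in `s`. -/
noncomputable def holdoutWeight [Fintype ι] [DecidableEq ι] [MeasurableSpace Z] (Pz : Measure Z)
    (L : List Z → H) (h₀ : H) (φ : H → Z → Bool) (q : H → Z → Δ) (s : Finset ι) (x : ι → Z) :
    ℝ≥0∞ :=
  Set.indicator {x | ∀ i, i ∉ s → φ (trainedDecision L h₀ φ q x s) (x i) = true}
    (fun x => (confidence Pz φ (trainedDecision L h₀ φ q x s) ^ sᶜ.card)⁻¹) x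

/-- The pieces may overlap. This suits the sets on which a given index list is a trace: repeated
data points allow several traces at once. -/
theorem measurable_of_forall_eqOn {X β κ : Type*} [MeasurableSpace X] [MeasurableSpace β]
    [Countable κ] {M : κ → Set X} (hM : ∀ i, MeasurableSet (M i)) (hcover : ∀ x, ∃ i, x ∈ M i)
    {g : X → β} (f : κ → X → β) (hf : ∀ i, Measurable (f i)) (hg : ∀ i, ∀ x ∈ M i, g x = f i x) :
    Measurable g := by
  intro A hA
  have : g ⁻¹' A = ⋃ i, M i ∩ f i ⁻¹' A := by
    ext x
    simp only [Set.mem_preimage, Set.mem_iUnion, Set.mem_inter_iff]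
    constructor
    · intro hx
      obtain ⟨i, hi⟩ := hcover x
      exact ⟨i, hi, hg i x hi ▸ hx⟩
    · rintro ⟨i, hi, hx⟩
      rw [hg i x hi]
      exact hx
  rw [this]
  exact MeasurableSet.iUnion fun i => (hM i).inter (hf i hA)

theorem map_eq_ofFn (x : ι → Z) (l : List ι) :
    l.map x = List.ofFn fun j : Fin l.length => x (l.get j) := by
  exact List.ext_get (by simp) (by simp)

theorem risk_eq [MeasurableSpace Z] {Pz : Measure Z} [IsProbabilityMeasure Pz] {φ : H → Z → Bool}
    {h : H} (hφ : Measurable (φ h)) : risk Pz φ h = 1 - (confidence Pz φ h).toReal := by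
  have hs : MeasurableSet {z | φ h z = true} := hφ (measurableSet_singleton true)
  have : {z | φ h z = false} = {z | φ h z = true}ᶜ := by ext; simp
  rw [risk, this, probReal_compl_eq_one_sub hs]
  rfl

theorem confidence_le_one [MeasurableSpace Z] {Pz : Measure Z} [IsProbabilityMeasure Pz]
    {φ : H → Z → Bool} {h : H} : confidence Pz φ h ≤ 1 := prob_le_one

variable [MeasurableSpace Z] {L : List Z → H} {h₀ : H} {φ : H → Z → Bool} {q : H → Z → Δ}
  [Fintype ι] [DecidableEq ι]

omit [Fintype ι] [DecidableEq ι] in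
theorem measurable_property
    (hφ_meas : ∀ k : ℕ, Measurable fun p : (Fin k → Z) × Z =>
      φ (decision L h₀ (List.ofFn p.1)) p.2) (l : List ι) :
    Measurable fun p : (ι → Z) × Z => φ (decision L h₀ (l.map p.1)) p.2 := by
  simp_rw [map_eq_ofFn]
  exact (hφ_meas l.length).comp
    (f := fun p : (ι → Z) × Z => ((fun j => p.1 (l.get j)), p.2)) (by fun_prop)

omit [Fintype ι] in
theorem measurableSet_isTrace
    (hφ_meas : ∀ k : ℕ, Measurable fun p : (Fin k → Z) × Z =>
      φ (decision L h₀ (List.ofFn p.1)) p.2)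
    (hq_meas : ∀ k : ℕ, MeasurableSet {p : (Fin k → Z) × Z × Z |
      φ (decision L h₀ (List.ofFn p.1)) p.2.1 = false ∧
      φ (decision L h₀ (List.ofFn p.1)) p.2.2 = false ∧
      q (decision L h₀ (List.ofFn p.1)) p.2.1 < q (decision L h₀ (List.ofFn p.1)) p.2.2})
    (s : Finset ι) (l l' : List ι) :
    MeasurableSet {x : ι → Z | IsTrace L h₀ φ q x s l l'} := by
  have hφ (l : List ι) (i : ι) (b : Bool) :
      MeasurableSet {x : ι → Z | φ (decision L h₀ (l.map x)) (x i) = b} :=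
    ((measurable_property hφ_meas l).comp (f := fun x : ι → Z => (x, x i)) (by fun_prop))
      (measurableSet_singleton b)
  induction l' generalizing s l with
  | nil =>
    simp only [IsTrace, Set.ofPred_forall]
    exact Finset.measurableSet_biInter s fun i _ => hφ l i true
  | cons i l' ih =>
    have hmax : MeasurableSet {x : ι → Z | ∀ j ∈ s,
        ¬ (φ (decision L h₀ (l.map x)) (x i) = false ∧
          φ (decision L h₀ (l.map x)) (x j) = false ∧
          q (decision L h₀ (l.map x)) (x i) < q (decision L h₀ (l.map x)) (x j))} := by
      simp only [Set.ofPred_forall]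
      refine Finset.measurableSet_biInter s fun j _ => MeasurableSet.compl ?_
      simp_rw [map_eq_ofFn]
      exact (hq_meas l.length).preimage
        (f := fun x : ι → Z => ((fun k => x (l.get k)), x i, x j)) (by fun_prop)
    exact (MeasurableSet.const _).inter ((hφ l i false).inter (hmax.inter (ih _ _)))

theorem measurable_comp_trainList
    (hq : ∀ h : H, Set.InjOn (q h) {z | φ h z = false})
    (hφ_meas : ∀ k : ℕ, Measurable fun p : (Fin k → Z) × Z =>
      φ (decision L h₀ (List.ofFn p.1)) p.2)
    (hq_meas : ∀ k : ℕ, MeasurableSet {p : (Fin k → Z) × Z × Z |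
      φ (decision L h₀ (List.ofFn p.1)) p.2.1 = false ∧
      φ (decision L h₀ (List.ofFn p.1)) p.2.2 = false ∧
      q (decision L h₀ (List.ofFn p.1)) p.2.1 < q (decision L h₀ (List.ofFn p.1)) p.2.2})
    (s : Finset ι) {β : Type*} [MeasurableSpace β] (g : List Z → (ι → Z) → β)
    (hg : ∀ l : List ι, Measurable fun x : ι → Z => g (l.map x) x) :
    Measurable fun x : ι → Z => g (trainList L h₀ φ q x s) x := by
  refine measurable_of_forall_eqOn (M := fun l : List ι => {x | IsTrace L h₀ φ q x s [] l})
    (fun l => measurableSet_isTrace hφ_meas hq_meas s [] l) (fun x => ?_)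
    (fun l x => g (l.map x) x) hg fun l x hx => ?_
  · obtain ⟨l, hl⟩ := exists_isTrace L h₀ φ q x s []
    refine ⟨l, ?_⟩
    rw [Set.mem_ofPred_eq]
    convert hl
  · rw [trainList_eq_of_isTrace hq hx]

omit [Fintype ι] [DecidableEq ι] in
theorem measurable_confidence_map (Pz : Measure Z) [IsProbabilityMeasure Pz]
    (hφ_meas : ∀ k : ℕ, Measurable fun p : (Fin k → Z) × Z =>
      φ (decision L h₀ (List.ofFn p.1)) p.2) (l : List ι) :
    Measurable fun x : ι → Z => confidence Pz φ (decision L h₀ (l.map x)) :=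
  measurable_measure_prodMk_left (ν := Pz)
    ((measurable_property hφ_meas l) (measurableSet_singleton true))

theorem measurable_holdoutWeight (Pz : Measure Z) [IsProbabilityMeasure Pz]
    (hq : ∀ h : H, Set.InjOn (q h) {z | φ h z = false})
    (hφ_meas : ∀ k : ℕ, Measurable fun p : (Fin k → Z) × Z =>
      φ (decision L h₀ (List.ofFn p.1)) p.2)
    (hq_meas : ∀ k : ℕ, MeasurableSet {p : (Fin k → Z) × Z × Z |
      φ (decision L h₀ (List.ofFn p.1)) p.2.1 = false ∧
      φ (decision L h₀ (List.ofFn p.1)) p.2.2 = false ∧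
      q (decision L h₀ (List.ofFn p.1)) p.2.1 < q (decision L h₀ (List.ofFn p.1)) p.2.2})
    (s : Finset ι) : Measurable (holdoutWeight Pz L h₀ φ q s) := by
  refine Measurable.indicator ?_ ?_
  · exact measurable_comp_trainList hq hφ_meas hq_meas s
      (fun T _ => (confidence Pz φ (decision L h₀ T) ^ sᶜ.card)⁻¹)
      fun l => ((measurable_confidence_map Pz hφ_meas l).pow_const _).inv
  · simp only [Set.ofPred_forall]
    refine MeasurableSet.iInter fun i => MeasurableSet.iInter fun _ => ?_
    refine (measurable_comp_trainList hq hφ_meas hq_meas s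
      (fun T x => φ (decision L h₀ T) (x i)) fun l => ?_) (measurableSet_singleton true)
    exact (measurable_property hφ_meas l).comp (f := fun x : ι → Z => (x, x i)) (by fun_prop)

/-- By Fubini, fix the points in `s`: the held-out points remain independent and all pass with
probability `c ^ sᶜ.card`, which the normalization cancels. Only an inequality holds, since the
product is 0 when that probability is 0. -/
theorem lintegral_holdoutWeight_le (Pz : Measure Z) [IsProbabilityMeasure Pz]
    (hq : ∀ h : H, Set.InjOn (q h) {z | φ h z = false})
    (hφ_meas : ∀ k : ℕ, Measurable fun p : (Fin k → Z) × Z =>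
      φ (decision L h₀ (List.ofFn p.1)) p.2)
    (hq_meas : ∀ k : ℕ, MeasurableSet {p : (Fin k → Z) × Z × Z |
      φ (decision L h₀ (List.ofFn p.1)) p.2.1 = false ∧
      φ (decision L h₀ (List.ofFn p.1)) p.2.2 = false ∧
      q (decision L h₀ (List.ofFn p.1)) p.2.1 < q (decision L h₀ (List.ofFn p.1)) p.2.2})
    (s : Finset ι) :
    ∫⁻ x, holdoutWeight Pz L h₀ φ q s x ∂(Measure.pi fun _ : ι => Pz) ≤ 1 := by
  have hmp := (measurePreserving_piEquivPiSubtypeProd (fun _ : ι => Pz) (· ∈ s)).symm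
  have hmeas := measurable_holdoutWeight Pz hq hφ_meas hq_meas s
  set e := (MeasurableEquiv.piEquivPiSubtypeProd (fun _ : ι => Z) (· ∈ s)).symm with he
  have he_in (a : {i // i ∈ s} → Z) (b : {i // ¬ i ∈ s} → Z) (i : ι) (hi : i ∈ s) :
      e (a, b) i = a ⟨i, hi⟩ := dif_pos hi
  have he_out (a : {i // i ∈ s} → Z) (b : {i // ¬ i ∈ s} → Z) (i : ι) (hi : ¬ i ∈ s) :
      e (a, b) i = b ⟨i, hi⟩ := dif_neg hi
  rw [← hmp.lintegral_comp hmeas,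
    lintegral_prod (fun p => holdoutWeight Pz L h₀ φ q s (e p))
      (hmeas.comp e.measurable).aemeasurable]
  refine (lintegral_mono (g := fun _ => 1) fun a => ?_).trans (by simp)
  obtain ⟨z₀⟩ : Nonempty Z := nonempty_of_isProbabilityMeasure Pz
  -- The value `z₀` is an arbitrary filler outside `s`, where the trained decision does not look.
  set h : H := trainedDecision L h₀ φ q (e (a, fun _ => z₀)) s with hh
  have hconst (b : {i // ¬ i ∈ s} → Z) : trainedDecision L h₀ φ q (e (a, b)) s = h := by
    rw [hh, trainedDecision, trainedDecision, trainList_congr]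
    intro i hi
    rw [he_in a _ i hi, he_in a _ i hi]
  have hle (b : {i // ¬ i ∈ s} → Z) : holdoutWeight Pz L h₀ φ q s (e (a, b))
      ≤ Set.indicator (Set.univ.pi fun _ => {z | φ h z = true})
        (fun _ => (confidence Pz φ h ^ sᶜ.card)⁻¹) b := by
    unfold holdoutWeight
    by_cases hb : ∀ i, i ∉ s → φ (trainedDecision L h₀ φ q (e (a, b)) s) (e (a, b) i) = true
    · rw [Set.indicator_of_mem (by exact hb), Set.indicator_of_mem, hconst]
      rintro ⟨i, hi⟩ -
      have := hb i hi
      rwa [hconst, he_out a b i hi] at this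
    · rw [Set.indicator_of_notMem (by exact hb)]
      exact zero_le
  calc _ ≤ ∫⁻ b, Set.indicator (Set.univ.pi fun _ => {z | φ h z = true})
        (fun _ => (confidence Pz φ h ^ sᶜ.card)⁻¹) b ∂(Measure.pi fun _ : {i // ¬ i ∈ s} => Pz) :=
      lintegral_mono hle
    _ ≤ (confidence Pz φ h ^ sᶜ.card)⁻¹ *
        (Measure.pi fun _ : {i // ¬ i ∈ s} => Pz) (Set.univ.pi fun _ => {z | φ h z = true}) :=
      lintegral_indicator_const_le _ _
    _ = (confidence Pz φ h ^ sᶜ.card)⁻¹ * confidence Pz φ h ^ sᶜ.card := by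
      rw [Measure.pi_pi, Finset.prod_const, confidence, Finset.card_univ,
        Fintype.card_subtype_compl, Fintype.card_coe, Finset.card_compl]
    _ ≤ 1 := by rw [mul_comm]; exact ENNReal.mul_inv_le_one _

/-! ### Pointwise lower bound on the sum of the weights -/

theorem choose_le_card_filter_powersetCard (J : Finset ι) {m : ℕ} (hm : J.card ≤ m) :
    (Fintype.card ι - J.card).choose (m - J.card)
      ≤ ((Finset.univ.powersetCard m).filter fun S => J ⊆ S).card := by
  rw [← Finset.card_compl, ← Finset.card_powersetCard]
  have hdisj : ∀ S ∈ Jᶜ.powersetCard (m - J.card), Disjoint J S := fun S hS =>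
    Finset.disjoint_left.2 fun i hi hi' =>
      Finset.mem_compl.1 ((Finset.mem_powersetCard.1 hS).1 hi') hi
  refine Finset.card_le_card_of_injOn (fun S => J ∪ S) ?_ ?_
  · intro S hS
    have hS' := Finset.mem_powersetCard.1 (Finset.mem_coe.1 hS)
    simp only [Finset.coe_filter, Finset.mem_powersetCard, Set.mem_ofPred_eq]
    refine ⟨⟨Finset.subset_univ _, ?_⟩, Finset.subset_union_left⟩
    rw [Finset.card_union_of_disjoint (hdisj S hS), hS'.2]
    omega
  · intro S hS S' hS' heq
    have h1 : (J ∪ S) \ J = S := Finset.union_sdiff_cancel_left (hdisj S hS)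
    have h2 : (J ∪ S') \ J = S' := Finset.union_sdiff_cancel_left (hdisj S' hS')
    rw [← h1, ← h2]
    exact congrArg (· \ J) heq

/-- Only the sets `S` containing all picked indices are counted. By stability each yields the
full-data decision and passes its test, so all these weights are equal. -/
theorem choose_mul_le_sum_holdoutWeight (Pz : Measure Z)
    (hq : ∀ h : H, Set.InjOn (q h) {z | φ h z = false}) (x : ι → Z) {m : ℕ}
    (hm : (trainList L h₀ φ q x Finset.univ).length ≤ m) :
    (((Fintype.card ι - (trainList L h₀ φ q x Finset.univ).length).choose
        (m - (trainList L h₀ φ q x Finset.univ).length) : ℕ) : ℝ≥0∞) *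
      (confidence Pz φ (trainedDecision L h₀ φ q x Finset.univ) ^ (Fintype.card ι - m))⁻¹
      ≤ ∑ S ∈ Finset.univ.powersetCard m, holdoutWeight Pz L h₀ φ q S x := by
  obtain ⟨l, hl⟩ : ∃ l, IsTrace L h₀ φ q x Finset.univ [] l := by
    obtain ⟨l, hl⟩ := exists_isTrace L h₀ φ q x Finset.univ []
    exact ⟨l, by convert hl⟩
  have hT := trainList_eq_of_isTrace hq hl
  have hcard : l.toFinset.card = (trainList L h₀ φ q x Finset.univ).length := by
    rw [hT, List.toFinset_card_of_nodup hl.subset_and_nodup.2, List.length_map]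
  rw [← hcard] at hm ⊢
  set c := confidence Pz φ (trainedDecision L h₀ φ q x Finset.univ) with hc
  have hweight : ∀ S ∈ (Finset.univ.powersetCard m).filter fun S => l.toFinset ⊆ S,
      holdoutWeight Pz L h₀ φ q S x = (c ^ (Fintype.card ι - m))⁻¹ := by
    intro S hS
    rw [Finset.mem_filter, Finset.mem_powersetCard] at hS
    have hlS : ∀ i ∈ l, i ∈ S := fun i hi => hS.2 (List.mem_toFinset.2 hi)
    have hdec : trainedDecision L h₀ φ q x S = trainedDecision L h₀ φ q x Finset.univ := by
      rw [trainedDecision, trainedDecision, hT,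
        trainList_eq_of_isTrace hq (hl.mono (Finset.subset_univ S) hlS)]
    rw [holdoutWeight, Set.indicator_of_mem, hdec, Finset.card_compl, hS.1.2]
    intro i hi
    rw [hdec, trainedDecision, hT]
    exact hl.satisfied (Finset.mem_univ i) fun h => hi (hlS i h)
  calc _ ≤ ((((Finset.univ.powersetCard m).filter fun S => l.toFinset ⊆ S).card : ℕ) : ℝ≥0∞) *
        (c ^ (Fintype.card ι - m))⁻¹ := by
        gcongr
        exact choose_le_card_filter_powersetCard _ hm
    _ = ∑ S ∈ (Finset.univ.powersetCard m).filter fun S => l.toFinset ⊆ S,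
          holdoutWeight Pz L h₀ φ q S x := by
        rw [Finset.sum_congr rfl hweight, Finset.sum_const, nsmul_eq_mul]
    _ ≤ _ := Finset.sum_le_sum_of_subset (Finset.filter_subset _ _)

omit [MeasurableSpace Z] in
theorem length_trainList_le (hq : ∀ h : H, Set.InjOn (q h) {z | φ h z = false}) (x : ι → Z)
    (s : Finset ι) : (trainList L h₀ φ q x s).length ≤ Fintype.card ι := by
  obtain ⟨l, hl⟩ := exists_isTrace L h₀ φ q x s []
  have hl' : IsTrace L h₀ φ q x s [] l := by convert hl
  rw [trainList_eq_of_isTrace hq hl', List.length_map]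
  exact hl'.subset_and_nodup.2.length_le_card

theorem one_le_sum_holdoutWeight (Pz : Measure Z) [IsProbabilityMeasure Pz] {N : ℕ}
    (hq : ∀ h : H, Set.InjOn (q h) {z | φ h z = false}) {δ : ℝ} (hδ : δ ∈ Set.Ioo (0 : ℝ) 1)
    (x : Fin N → Z) (hφ : Measurable (φ (trainedDecision L h₀ φ q x Finset.univ)))
    (hbad : epsBar (trainList L h₀ φ q x Finset.univ).length δ N
      < risk Pz φ (trainedDecision L h₀ φ q x Finset.univ)) :
    1 ≤ ENNReal.ofReal (δ / N) * ∑ m ∈ Finset.range N, ((N.choose m : ℕ) : ℝ≥0∞)⁻¹ *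
      ∑ S ∈ Finset.univ.powersetCard m, holdoutWeight Pz L h₀ φ q S x := by
  have hkey := fun m => choose_mul_le_sum_holdoutWeight (h₀ := h₀) (L := L) Pz hq x (m := m)
  have hle := length_trainList_le (L := L) (h₀ := h₀) hq x Finset.univ
  rw [Fintype.card_fin] at hle
  rw [Fintype.card_fin] at hkey
  set k := (trainList L h₀ φ q x Finset.univ).length with hk
  set c := confidence Pz φ (trainedDecision L h₀ φ q x Finset.univ) with hc
  set r := risk Pz φ (trainedDecision L h₀ φ q x Finset.univ) with hr
  have hrc : r = 1 - c.toReal := risk_eq hφ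
  have hc1 : c ≤ 1 := confidence_le_one
  have hcT : c ≠ ∞ := ne_top_of_le_ne_top ENNReal.one_ne_top hc1
  -- If all `N` points were picked, the bound would be 1, which no risk exceeds.
  have hkN : k < N := by
    refine lt_of_le_of_ne hle fun h => ?_
    rw [epsBar, if_neg (by omega)] at hbad
    linarith [ENNReal.toReal_nonneg (a := c)]
  have hN : (0 : ℝ) < N := by exact_mod_cast (by omega : 0 < N)
  have hlower : ENNReal.ofReal (δ / N) * ∑ m ∈ Finset.Ico k N, ((N.choose m : ℕ) : ℝ≥0∞)⁻¹ *
      ((((N - k).choose (m - k) : ℕ) : ℝ≥0∞) * (c ^ (N - m))⁻¹)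
      ≤ ENNReal.ofReal (δ / N) * ∑ m ∈ Finset.range N, ((N.choose m : ℕ) : ℝ≥0∞)⁻¹ *
      ∑ S ∈ Finset.univ.powersetCard m, holdoutWeight Pz L h₀ φ q S x := by
    gcongr
    refine (Finset.sum_le_sum fun m hm => ?_).trans (Finset.sum_le_sum_of_subset
      fun m hm => Finset.mem_range.2 (Finset.mem_Ico.1 hm).2)
    gcongr
    exact hkey m (Finset.mem_Ico.1 hm).1
  refine le_trans ?_ hlower
  have hδN : 0 < δ / N := div_pos hδ.1 hN
  -- At `c = 0` the risk is 1, where the real-valued Ψ is 0 by convention and useless; in `ℝ≥0∞` the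
  -- summand `m = k` is infinite instead.
  rcases eq_or_ne c 0 with h0 | h0
  · have htop : ((N.choose k : ℕ) : ℝ≥0∞)⁻¹ *
        ((((N - k).choose (k - k) : ℕ) : ℝ≥0∞) * (c ^ (N - k))⁻¹) = ∞ := by
      rw [h0, zero_pow (by omega), ENNReal.inv_zero, Nat.sub_self, Nat.choose_zero_right,
        Nat.cast_one, one_mul, ENNReal.mul_top]
      simp
    have : ∑ m ∈ Finset.Ico k N, ((N.choose m : ℕ) : ℝ≥0∞)⁻¹ *
        ((((N - k).choose (m - k) : ℕ) : ℝ≥0∞) * (c ^ (N - m))⁻¹) = ∞ :=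
      ENNReal.sum_eq_top.2 ⟨k, Finset.mem_Ico.2 ⟨le_rfl, hkN⟩, htop⟩
    rw [this, ENNReal.mul_top (by simpa using hδN)]
    exact le_top
  · have hcpos : 0 < c.toReal := ENNReal.toReal_pos h0 hcT
    have hPsi := one_le_Psi_of_epsBar_lt hkN hδ hbad (by linarith)
    have hcr : c = ENNReal.ofReal (1 - r) := by
      rw [hrc, sub_sub_cancel, ENNReal.ofReal_toReal hcT]
    have h1r : 0 < 1 - r := by linarith
    rw [← ENNReal.ofReal_one]
    refine (ENNReal.ofReal_le_ofReal hPsi).trans (le_of_eq ?_)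
    rw [Psi_eq, ENNReal.ofReal_mul hδN.le, ENNReal.ofReal_sum_of_nonneg fun m _ => by positivity]
    congr 1
    refine Finset.sum_congr rfl fun m hm => ?_
    obtain ⟨h1, h2⟩ := Finset.mem_Ico.1 hm
    have hC : (0 : ℝ) < (N.choose m : ℝ) := by exact_mod_cast Nat.choose_pos h2.le
    rw [choose_div_choose_eq h1 h2.le, hcr, ENNReal.ofReal_mul (by positivity),
      ENNReal.ofReal_div_of_pos hC, ENNReal.ofReal_inv_of_pos (by positivity),
      ENNReal.ofReal_pow h1r.le, ENNReal.ofReal_natCast, ENNReal.ofReal_natCast,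
      ENNReal.div_eq_inv_mul, mul_assoc]

end PickToLearn

/-! ### Markov's inequality and the theorem -/

namespace PickToLearn

open scoped ENNReal

/-- Markov's inequality at level 1: each of the `N` sizes `m` contributes at most `δ / N` to the
mean, because `(N choose m)` normalizes the sum over sets of size `m`. -/
theorem measure_epsBar_lt_risk_le {Z H Δ : Type*} [MeasurableSpace Z] [LinearOrder Δ]
    {L : List Z → H} {h₀ : H} {φ : H → Z → Bool} {q : H → Z → Δ}
    (hq : ∀ h : H, Set.InjOn (q h) {z | φ h z = false})
    (hφ_meas : ∀ k : ℕ, Measurable fun p : (Fin k → Z) × Z =>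
      φ (decision L h₀ (List.ofFn p.1)) p.2)
    (hq_meas : ∀ k : ℕ, MeasurableSet {p : (Fin k → Z) × Z × Z |
      φ (decision L h₀ (List.ofFn p.1)) p.2.1 = false ∧
      φ (decision L h₀ (List.ofFn p.1)) p.2.2 = false ∧
      q (decision L h₀ (List.ofFn p.1)) p.2.1 < q (decision L h₀ (List.ofFn p.1)) p.2.2})
    (Pz : Measure Z) [IsProbabilityMeasure Pz] (N : ℕ) {δ : ℝ} (hδ : δ ∈ Set.Ioo (0 : ℝ) 1) :
    (Measure.pi fun _ : Fin N => Pz)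
      {x | epsBar (trainList L h₀ φ q x Finset.univ).length δ N
        < risk Pz φ (trainedDecision L h₀ φ q x Finset.univ)} ≤ ENNReal.ofReal δ := by
  set bound : (Fin N → Z) → ℝ≥0∞ := fun x =>
    ENNReal.ofReal (δ / N) * ∑ m ∈ Finset.range N, ((N.choose m : ℕ) : ℝ≥0∞)⁻¹ *
      ∑ S ∈ Finset.univ.powersetCard m, holdoutWeight Pz L h₀ φ q S x with hbound
  have hw := measurable_holdoutWeight (ι := Fin N) Pz hq hφ_meas hq_meas
  -- Joint measurability is sliced at the training list that `x` produces.
  have hφ (x : Fin N → Z) : Measurable (φ (trainedDecision L h₀ φ q x Finset.univ)) := by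
    have := hφ_meas (trainList L h₀ φ q x Finset.univ).length
    simpa [trainedDecision, Function.comp_def] using this.comp
      (f := fun z : Z => ((trainList L h₀ φ q x Finset.univ).get, z)) (by fun_prop)
  calc _ ≤ (Measure.pi fun _ : Fin N => Pz) {x | 1 ≤ bound x} :=
        measure_mono fun x hx => one_le_sum_holdoutWeight Pz hq hδ x (hφ x) hx
    _ ≤ ∫⁻ x, bound x ∂(Measure.pi fun _ : Fin N => Pz) := by
        refine (meas_ge_le_lintegral_div (f := bound) (by fun_prop) one_ne_zero
          ENNReal.one_ne_top).trans (by simp)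
    _ = ENNReal.ofReal (δ / N) * ∑ m ∈ Finset.range N, ((N.choose m : ℕ) : ℝ≥0∞)⁻¹ *
          ∑ S ∈ Finset.univ.powersetCard m,
            ∫⁻ x, holdoutWeight Pz L h₀ φ q S x ∂(Measure.pi fun _ : Fin N => Pz) := by
        rw [hbound, lintegral_const_mul _ (by fun_prop), lintegral_finsetSum _ (by fun_prop)]
        congr 1
        refine Finset.sum_congr rfl fun m _ => ?_
        rw [lintegral_const_mul _ (by fun_prop), lintegral_finsetSum _ (by fun_prop)]
    _ ≤ ENNReal.ofReal (δ / N) * ∑ m ∈ Finset.range N, ((N.choose m : ℕ) : ℝ≥0∞)⁻¹ *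
          ∑ S ∈ (Finset.univ : Finset (Fin N)).powersetCard m, 1 := by
        gcongr
        exact lintegral_holdoutWeight_le Pz hq hφ_meas hq_meas _
    _ ≤ ENNReal.ofReal (δ / N) * ∑ m ∈ Finset.range N, 1 := by
        gcongr with m hm
        rw [Finset.sum_const, Finset.card_powersetCard, Finset.card_univ, Fintype.card_fin,
          nsmul_one, mul_comm]
        exact ENNReal.mul_inv_le_one _
    _ = ENNReal.ofReal (δ / N * N) := by
        rw [ENNReal.ofReal_mul (div_nonneg hδ.1.le N.cast_nonneg), ENNReal.ofReal_natCast]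
        simp
    _ ≤ ENNReal.ofReal δ := by
        refine ENNReal.ofReal_le_ofReal ?_
        rcases eq_or_ne (N : ℝ) 0 with h | h
        · simp [h, hδ.1.le]
        · rw [div_mul_cancel₀ _ h]

end PickToLearn

theorem theorem1 {Ω Z H Δ : Type*} [MeasurableSpace Ω] [MeasurableSpace Z] [LinearOrder Δ]
    -- the synthesis algorithm, the initial decision, the property, the degree of dissatisfaction
    (L : List Z → H) (h₀ : H) (φ : H → Z → Bool) (q : H → Z → Δ)
    -- distinct unsatisfied points have distinct degrees of dissatisfaction
    (hq : ∀ h : H, Set.InjOn (q h) {z | φ h z = false})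
    -- measurability of the property and of the comparison of degrees, along training lists
    (hφ_meas : ∀ k : ℕ, Measurable fun p : (Fin k → Z) × Z =>
      φ (PickToLearn.decision L h₀ (List.ofFn p.1)) p.2)
    (hq_meas : ∀ k : ℕ, MeasurableSet {p : (Fin k → Z) × Z × Z |
      φ (PickToLearn.decision L h₀ (List.ofFn p.1)) p.2.1 = false ∧
      φ (PickToLearn.decision L h₀ (List.ofFn p.1)) p.2.2 = false ∧
      q (PickToLearn.decision L h₀ (List.ofFn p.1)) p.2.1
        < q (PickToLearn.decision L h₀ (List.ofFn p.1)) p.2.2})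
    -- the data: independent draws from the distribution `Pz`
    (μ : Measure Ω) [IsProbabilityMeasure μ] (Pz : Measure Z) [IsProbabilityMeasure Pz]
    (N : ℕ) (z : Fin N → Ω → Z) (hz_meas : ∀ i, Measurable (z i))
    (hz_indep : iIndepFun z μ) (hz_law : ∀ i, Measure.map (z i) μ = Pz)
    (δ : ℝ) (hδ : δ ∈ Set.Ioo (0 : ℝ) 1) :
    (∀ k < N, ∃! ε : ℝ, PickToLearn.IsPsiRoot N k δ ε) ∧
    MeasurableSet {ω : Ω |
      PickToLearn.risk Pz φ (PickToLearn.P2L L h₀ φ q (List.ofFn fun i => z i ω)).1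
        ≤ PickToLearn.epsBar
            (PickToLearn.P2L L h₀ φ q (List.ofFn fun i => z i ω)).2.length δ N} ∧
    ENNReal.ofReal (1 - δ) ≤ μ {ω : Ω |
      PickToLearn.risk Pz φ (PickToLearn.P2L L h₀ φ q (List.ofFn fun i => z i ω)).1
        ≤ PickToLearn.epsBar
            (PickToLearn.P2L L h₀ φ q (List.ofFn fun i => z i ω)).2.length δ N} := by
  have hz : Measurable fun ω i => z i ω := measurable_pi_lambda _ hz_meas
  set bad : Set (Fin N → Z) :=
    {x | PickToLearn.epsBar (PickToLearn.trainList L h₀ φ q x Finset.univ).length δ N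
      < PickToLearn.risk Pz φ (PickToLearn.trainedDecision L h₀ φ q x Finset.univ)} with hbad
  have hbad_meas : MeasurableSet bad := by
    refine measurableSet_lt ?_ ?_
    · exact PickToLearn.measurable_comp_trainList hq hφ_meas hq_meas Finset.univ
        (fun T _ => PickToLearn.epsBar T.length δ N) fun l => by
          simp only [List.length_map]; exact measurable_const
    · refine PickToLearn.measurable_comp_trainList hq hφ_meas hq_meas Finset.univ
        (fun T _ => PickToLearn.risk Pz φ (PickToLearn.decision L h₀ T)) fun l => ?_
      exact (measurable_measure_prodMk_left (ν := Pz)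
        ((PickToLearn.measurable_property hφ_meas l) (measurableSet_singleton false))).ennreal_toReal
  have hset : {ω : Ω |
      PickToLearn.risk Pz φ (PickToLearn.P2L L h₀ φ q (List.ofFn fun i => z i ω)).1
        ≤ PickToLearn.epsBar
            (PickToLearn.P2L L h₀ φ q (List.ofFn fun i => z i ω)).2.length δ N}
      = ((fun ω i => z i ω) ⁻¹' bad)ᶜ := by
    ext ω
    simp [hbad, PickToLearn.P2L_ofFn hq, PickToLearn.trainedDecision]
  -- Independence and the common law enter only here, transferring the product-measure bound to the
  -- sample.
  have hlaw : μ.map (fun ω i => z i ω) = Measure.pi fun _ : Fin N => Pz := by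
    rw [(iIndepFun_iff_map_fun_eq_pi_map fun i => (hz_meas i).aemeasurable).1 hz_indep]
    simp_rw [hz_law]
  refine ⟨fun k hk => PickToLearn.existsUnique_isPsiRoot hk hδ, ?_, ?_⟩
  · rw [hset]
    exact (hz hbad_meas).compl
  · rw [hset, prob_compl_eq_one_sub (hz hbad_meas), ← Measure.map_apply hz hbad_meas, hlaw,
      ENNReal.ofReal_sub _ hδ.1.le, ENNReal.ofReal_one]
    exact tsub_le_tsub_left
      (PickToLearn.measure_epsBar_lt_risk_le hq hφ_meas hq_meas Pz N hδ) 1
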